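/- Let $-\infty\le\alpha<\beta\le\infty$, let $I=(\alpha,\beta)\subseteq\mathbb{R}$, and let $r\in\{0,1,2,\dots\}\cup\{\infty\}$. Let $f\colon I\to\mathbb{R}$ be of class $\mathcal{C}^r$, and let $\varepsilon,\rho\colon I\to\mathbb{R}$ be continuous functions with $\varepsilon(t)>0$ and $r\ge\rho(t)\ge 0$ for all $t\in I$. Then there is a real-analytic function $g\colon I\to\mathbb{R}$ such that $$\bigl|(f-g)^{(n)}(t)\bigr|<\varepsilon(t)\qquad\text{for all } t\in I \text{ and all integers } n \text{ with } 0\le n\le\rho(t),$$ and such that $g$ extends to a holomorphic function $\mathbb{C}\setminus\{\alpha,\beta\}\to\mathbb{C}$ (where an infinite endpoint is not a point of $\mathbb{C}$, so that only the finite ones among $\alpha,\beta$ are removed). -/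

import Mathlib

/-- The open interval of real numbers with the extended real endpoints `α` and `β`. -/
def realInterval (α β : EReal) : Set ℝ :=
  {t : ℝ | α < (t : EReal) ∧ (t : EReal) < β}

/-- The complex plane with those of the endpoints `α`, `β` removed that are finite
(infinite endpoints are not points of the plane). -/
def planeMinusEndpoints (α β : EReal) : Set ℂ :=
  {z : ℂ | ∀ a : ℝ, (a : EReal) = α ∨ (a : EReal) = β → z ≠ (a : ℂ)}

/-!
The interval is straightened first: it carries a rational coordinate `φ`, real on the interval and
holomorphic off the finite endpoints, whose inverse `ψ` is a smooth map from the whole line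
(`exists_coordinate`). If an entire `G` approximates `f ∘ ψ` on the line, then `G ∘ φ` approximates
`f`, and by the Faà di Bruno bound the loss in the derivatives is locally bounded
(`exists_holomorphic_approx_of_coordinate`). It remains to approximate on the line by entire
functions (`exists_entire_approx`), which is Carleman's theorem with derivatives.

On the line, a compactly supported `h` is approximated together with its derivatives by convolution
with a narrow Gaussian, and such a convolution is entire. If `h` vanishes on `|t| < R`, the
convolution also tends to zero uniformly on the disc `‖z‖ < R / 3`, since there
`Re (z - s)² ≥ R² / 3` for `|s| ≥ R` (`exists_entire_approx_of_hasCompactSupport`). As in Whitney's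
approximation theorem, one cuts off the error of the current approximation so that what remains
lives on `k ≤ |t| ≤ k + 3`, and adds a Gaussian approximation of it
(`exists_entire_correction`). This settles `k + 1 ≤ |t| ≤ k + 2`, hardly affects `|t| ≤ k`, and
multiplies the error on `k ≤ |t| ≤ k + 1` by a constant known in advance. Hence tolerances can be
fixed beforehand, and smallness on growing discs makes the partial sums converge locally uniformly
on the plane, with all derivatives.
-/

open MeasureTheory Filter Topology

/-! ### Gaussian mollification of compactly supported functions -/

/-- The Gaussian density `t ↦ √(b / π) exp (-b t²)` on the line. -/
noncomputable def gaussianDensity (b t : ℝ) : ℝ :=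
  √(b / Real.pi) * Real.exp (-b * t ^ 2)

/-- The convolution of a function `h` on the line with the Gaussian density of parameter `b`,
evaluated at a complex point. -/
noncomputable def gaussianMollify (b : ℝ) (h : ℝ → ℝ) (z : ℂ) : ℂ :=
  ∫ s : ℝ, (h s : ℂ) * ((√(b / Real.pi) : ℝ) * Complex.exp (-b * (z - s) ^ 2))

lemma continuous_gaussianDensity (b : ℝ) : Continuous (gaussianDensity b) := by
  unfold gaussianDensity; fun_prop

lemma integral_gaussianDensity {b : ℝ} (hb : 0 < b) : ∫ t, gaussianDensity b t = 1 := by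
  unfold gaussianDensity
  rw [integral_const_mul, integral_gaussian, ← Real.sqrt_mul (by positivity)]
  have : b / Real.pi * (Real.pi / b) = 1 := by
    have := Real.pi_pos
    field_simp
  rw [this, Real.sqrt_one]

lemma integrable_gaussianDensity {b : ℝ} (hb : 0 < b) : Integrable (gaussianDensity b) :=
  (integrable_exp_neg_mul_sq hb).const_mul _

lemma gaussianDensity_nonneg (b t : ℝ) : 0 ≤ gaussianDensity b t := by
  unfold gaussianDensity; positivity

lemma tendsto_sqrt_mul_exp_neg {a : ℝ} (ha : 0 < a) :
    Tendsto (fun b : ℝ => √(b / Real.pi) * Real.exp (-a * b)) atTop (𝓝 0) := by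
  have := (tendsto_rpow_mul_exp_neg_mul_atTop_nhds_zero (1 / 2) a ha).div_const √Real.pi
  rw [zero_div] at this
  refine this.congr fun b => ?_
  rw [Real.sqrt_div' _ Real.pi_pos.le, Real.sqrt_eq_rpow b]
  ring

lemma gaussianMollify_ofReal (b : ℝ) (h : ℝ → ℝ) (x : ℝ) :
    gaussianMollify b h x =
      ((convolution h (gaussianDensity b) (ContinuousLinearMap.lsmul ℝ ℝ) volume x : ℝ) : ℂ) := by
  rw [convolution_def, ← integral_complex_ofReal]
  unfold gaussianMollify gaussianDensity
  congr 1
  ext s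
  simp

lemma hasCompactSupport_iteratedDeriv {h : ℝ → ℝ} (hc : HasCompactSupport h) (n : ℕ) :
    HasCompactSupport (iteratedDeriv n h) := by
  induction n with
  | zero => simpa
  | succ n ih => rw [iteratedDeriv_succ]; exact ih.deriv

lemma iteratedDeriv_convolution_gaussianDensity (b : ℝ) {h : ℝ → ℝ} (hc : HasCompactSupport h)
    {n : ℕ} (hh : ContDiff ℝ n h) :
    iteratedDeriv n (convolution h (gaussianDensity b) (ContinuousLinearMap.lsmul ℝ ℝ) volume) =
      convolution (iteratedDeriv n h) (gaussianDensity b)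
        (ContinuousLinearMap.lsmul ℝ ℝ) volume := by
  induction n with
  | zero => simp
  | succ n ih =>
    have h1 : ContDiff ℝ 1 (iteratedDeriv n h) := by
      rw [iteratedDeriv_eq_iterate]
      exact ContDiff.iterate_deriv' 1 n (by simpa [add_comm] using hh)
    have h2 := hasCompactSupport_iteratedDeriv hc n
    rw [iteratedDeriv_succ, ih (hh.of_le (by norm_cast; omega))]
    ext x
    rw [(h2.hasDerivAt_convolution_left _ h1
      (continuous_gaussianDensity b).locallyIntegrable x).deriv, iteratedDeriv_succ]

/-- Convolutions with Gaussians of growing concentration converge uniformly. -/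
lemma eventually_abs_sub_convolution_gaussianDensity_le {w : ℝ → ℝ} (hw : Continuous w)
    (hc : HasCompactSupport w) {e : ℝ} (he : 0 < e) :
    ∀ᶠ b in atTop, ∀ x, |w x -
      convolution w (gaussianDensity b) (ContinuousLinearMap.lsmul ℝ ℝ) volume x| ≤ e := by
  obtain ⟨M, hM⟩ := hc.exists_bound_of_continuous hw
  have hM0 : 0 ≤ M := (norm_nonneg _).trans (hM 0)
  obtain ⟨d, hd, hu⟩ := Metric.uniformContinuous_iff.1
    (hc.uniformContinuous_of_continuous hw) (e / 2) (half_pos he)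
  have ht : Tendsto (fun b : ℝ => 2 * M * √2 * Real.exp (-(d ^ 2 / 2 * b))) atTop (𝓝 0) := by
    have : Tendsto (fun b : ℝ => d ^ 2 / 2 * b) atTop atTop :=
      tendsto_id.const_mul_atTop (by positivity)
    simpa using (Real.tendsto_exp_neg_atTop_nhds_zero.comp this).const_mul (2 * M * √2)
  filter_upwards [ht.eventually_lt_const (half_pos he), eventually_gt_atTop 0] with b hb hb0 x
  -- Chernoff's device: the indicator of `d ≤ |s|` is at most `exp (b / 2 * (s² - d²))`.
  have key : ∀ s, |w x - w (x - s)| ≤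
      e / 2 + 2 * M * Real.exp (b / 2 * s ^ 2) * Real.exp (-(d ^ 2 / 2 * b)) := by
    intro s
    by_cases hs : |s| < d
    · have : dist (w x) (w (x - s)) < e / 2 := hu (by simpa [Real.dist_eq] using hs)
      rw [Real.dist_eq] at this
      have : 0 ≤ 2 * M * Real.exp (b / 2 * s ^ 2) * Real.exp (-(d ^ 2 / 2 * b)) := by positivity
      linarith
    · have h1 : |w x - w (x - s)| ≤ 2 * M := by
        have := abs_sub (w x) (w (x - s))
        have := hM x
        have := hM (x - s)
        simp only [Real.norm_eq_abs] at *
        linarith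
      have h2 : 1 ≤ Real.exp (b / 2 * s ^ 2) * Real.exp (-(d ^ 2 / 2 * b)) := by
        rw [← Real.exp_add]
        apply Real.one_le_exp
        have : d ^ 2 ≤ s ^ 2 := by
          rw [← sq_abs s]; exact pow_le_pow_left₀ hd.le (not_lt.1 hs) 2
        nlinarith
      nlinarith
  have hsplit : ∀ s, (2 * M * Real.exp (b / 2 * s ^ 2) * Real.exp (-(d ^ 2 / 2 * b))) *
      gaussianDensity b s =
      (2 * M * √2 * Real.exp (-(d ^ 2 / 2 * b))) * gaussianDensity (b / 2) s := by
    intro s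
    unfold gaussianDensity
    have h1 : √(b / Real.pi) = √2 * √(b / 2 / Real.pi) := by
      rw [← Real.sqrt_mul (by norm_num)]; congr 1; ring
    have h2 : Real.exp (-(b / 2) * s ^ 2) = Real.exp (b / 2 * s ^ 2) * Real.exp (-b * s ^ 2) := by
      rw [← Real.exp_add]; congr 1; ring
    rw [h1, h2]; ring
  have hint1 : Integrable fun s => w (x - s) * gaussianDensity b s :=
    (integrable_gaussianDensity hb0).bdd_mul (c := M) (by fun_prop)
      (Eventually.of_forall fun s => hM _)
  have hint2 : Integrable fun s => w x * gaussianDensity b s :=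
    (integrable_gaussianDensity hb0).const_mul _
  have hint3 := (integrable_gaussianDensity hb0).const_mul (e / 2)
  have hint4 := (integrable_gaussianDensity (half_pos hb0)).const_mul
    (2 * M * √2 * Real.exp (-(d ^ 2 / 2 * b)))
  have hconv : w x - convolution w (gaussianDensity b) (ContinuousLinearMap.lsmul ℝ ℝ) volume x =
      ∫ s, (w x - w (x - s)) * gaussianDensity b s := by
    rw [convolution_eq_swap]
    simp only [ContinuousLinearMap.lsmul_apply, smul_eq_mul, sub_mul]
    rw [integral_sub hint2 hint1, integral_const_mul, integral_gaussianDensity hb0, mul_one]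
  rw [hconv]
  calc |∫ s, (w x - w (x - s)) * gaussianDensity b s|
      ≤ ∫ s, (e / 2 * gaussianDensity b s +
          (2 * M * √2 * Real.exp (-(d ^ 2 / 2 * b))) * gaussianDensity (b / 2) s) := by
        refine norm_integral_le_of_norm_le (G := ℝ) (hint3.add hint4)
          (Eventually.of_forall fun s => ?_)
        rw [← hsplit, ← add_mul, norm_mul, Real.norm_eq_abs, Real.norm_eq_abs,
          abs_of_nonneg (gaussianDensity_nonneg b s)]
        exact mul_le_mul_of_nonneg_right (key s) (gaussianDensity_nonneg b s)
    _ = e / 2 + 2 * M * √2 * Real.exp (-(d ^ 2 / 2 * b)) := by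
        rw [integral_add hint3 hint4, integral_const_mul, integral_const_mul,
          integral_gaussianDensity hb0, integral_gaussianDensity (half_pos hb0), mul_one, mul_one]
    _ ≤ e := by linarith

lemma differentiable_gaussianMollify (b : ℝ) {h : ℝ → ℝ} (hh : Continuous h)
    (hc : HasCompactSupport h) : Differentiable ℂ (gaussianMollify b h) := by
  intro z₀
  set F : ℂ → ℝ → ℂ := fun z s => (h s : ℂ) * ((√(b / Real.pi) : ℝ) *
    Complex.exp (-b * (z - s) ^ 2)) with hF
  set F' : ℂ → ℝ → ℂ := fun z s => (h s : ℂ) * ((√(b / Real.pi) : ℝ) *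
    (Complex.exp (-b * (z - s) ^ 2) * (-b * (2 * (z - s))))) with hF'
  have hd : ∀ z s, HasDerivAt (fun z => F z s) (F' z s) z := by
    intro z s
    have h1 : HasDerivAt (fun z : ℂ => -(b : ℂ) * (z - s) ^ 2) (-b * (2 * (z - s))) z := by
      have := (((hasDerivAt_id z).sub_const (s : ℂ)).pow 2).const_mul (-(b : ℂ))
      simpa using this
    exact ((h1.cexp).const_mul _).const_mul _
  have hcont : Continuous fun p : ℂ × ℝ => F' p.1 p.2 := by
    simp only [hF']; fun_prop
  obtain ⟨C, hC⟩ := ((isCompact_closedBall z₀ 1).prod hc.isCompact).exists_bound_of_continuousOn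
    hcont.continuousOn
  have hbd : ∀ s, ∀ z ∈ Metric.ball z₀ 1, ‖F' z s‖ ≤ (tsupport h).indicator (fun _ => C) s := by
    intro s z hz
    by_cases hs : s ∈ tsupport h
    · rw [Set.indicator_of_mem hs]
      exact hC (z, s) ⟨Metric.ball_subset_closedBall hz, hs⟩
    · rw [Set.indicator_of_notMem hs]
      simp [hF', image_eq_zero_of_notMem_tsupport hs]
  have hcF : ∀ z, Continuous (F z) := fun z => by simp only [hF]; fun_prop
  have hsupp : ∀ z, HasCompactSupport (F z) := fun z => by
    refine hc.mono fun s hs hs0 => hs ?_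
    simp [hF, hs0]
  refine (hasDerivAt_integral_of_dominated_loc_of_deriv_le (F := F) (F' := F')
    (bound := (tsupport h).indicator fun _ => C)
    (Metric.ball_mem_nhds z₀ one_pos) (Eventually.of_forall fun z => (hcF z).aestronglyMeasurable)
    ((hcF z₀).integrable_of_hasCompactSupport (hsupp z₀))
    (by simp only [hF']; exact (by fun_prop : Continuous _).aestronglyMeasurable)
    (Eventually.of_forall fun s => hbd s) ?_
    (Eventually.of_forall fun s z _ => hd z s)).2.differentiableAt
  exact (integrable_indicator_iff (isClosed_tsupport h).measurableSet).2
    (integrableOn_const hc.isCompact.measure_lt_top.ne)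

/-- If `h` vanishes near the origin, its Gaussian mollifications are small on a complex disc,
because `Re (z - s)²` stays positive for `s` outside a much larger interval. -/
lemma eventually_norm_gaussianMollify_lt {h : ℝ → ℝ} (hh : Continuous h)
    (hc : HasCompactSupport h) {R : ℝ} (hR : ∀ t, |t| < R → h t = 0) {e : ℝ} (he : 0 < e) :
    ∀ᶠ b in atTop, ∀ z : ℂ, ‖z‖ < R / 3 → ‖gaussianMollify b h z‖ < e := by
  rcases le_or_gt R 0 with h0 | h0
  · refine Eventually.of_forall fun b z hz => ?_
    have := norm_nonneg z
    linarith
  have hi : Integrable h := hh.integrable_of_hasCompactSupport hc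
  have ht := (tendsto_sqrt_mul_exp_neg (a := R ^ 2 / 3) (by positivity)).const_mul (∫ s, ‖h s‖)
  rw [mul_zero] at ht
  filter_upwards [ht.eventually_lt_const he, eventually_gt_atTop 0] with b hb hb0 z hz
  refine lt_of_le_of_lt ?_ hb
  rw [← integral_mul_const]
  refine norm_integral_le_of_norm_le (hi.norm.mul_const _) (Eventually.of_forall fun s => ?_)
  by_cases hs : |s| < R
  · simp [hR s hs]
  rw [norm_mul, norm_mul, Complex.norm_real, Complex.norm_real, Complex.norm_exp,
    Real.norm_of_nonneg (Real.sqrt_nonneg _)]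
  gcongr
  have hre : (-(b : ℂ) * (z - s) ^ 2).re = -b * ((z.re - s) ^ 2 - z.im ^ 2) := by
    simp [pow_two, Complex.mul_re]
  rw [hre]
  have h1 : z.re ^ 2 + z.im ^ 2 < (R / 3) ^ 2 := by
    have := pow_lt_pow_left₀ hz (norm_nonneg _) two_ne_zero
    rw [Complex.sq_norm, Complex.normSq_apply] at this
    nlinarith
  have h2 : |z.re| < R / 3 := (Complex.abs_re_le_norm z).trans_lt hz
  have h3 : 2 * R / 3 ≤ |z.re - s| := by
    have := abs_sub_abs_le_abs_sub s z.re
    rw [abs_sub_comm] at this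
    linarith [not_lt.1 hs]
  have h4 : (2 * R / 3) ^ 2 ≤ (z.re - s) ^ 2 := by
    rw [← sq_abs (z.re - s)]; exact pow_le_pow_left₀ (by positivity) h3 2
  have h5 : R ^ 2 / 3 ≤ (z.re - s) ^ 2 - z.im ^ 2 := by nlinarith [sq_nonneg z.re]
  nlinarith

/-- Approximation of a compactly supported function, with its derivatives, on the whole line by an
entire function which is small on a disc if the given function vanishes around the origin. -/
lemma exists_entire_approx_of_hasCompactSupport {h : ℝ → ℝ} {m : ℕ} (hh : ContDiff ℝ m h)
    (hc : HasCompactSupport h) {R : ℝ} (hR : ∀ t, |t| < R → h t = 0) {e : ℝ} (he : 0 < e) :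
    ∃ G : ℂ → ℂ, Differentiable ℂ G ∧ (∀ t : ℝ, (G t).im = 0) ∧
      (∀ n ≤ m, ∀ t, |iteratedDeriv n (fun s => h s - (G s).re) t| ≤ e) ∧
      ∀ z, ‖z‖ < R / 3 → ‖G z‖ < e := by
  have hev : ∀ᶠ b in atTop, ∀ n ∈ Finset.range (m + 1), ∀ x, |iteratedDeriv n h x -
      convolution (iteratedDeriv n h) (gaussianDensity b)
        (ContinuousLinearMap.lsmul ℝ ℝ) volume x| ≤ e := by
    rw [Finset.eventually_all]
    intro n hn
    have hn : n ≤ m := by simpa [Nat.lt_succ_iff] using hn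
    refine eventually_abs_sub_convolution_gaussianDensity_le
      (hh.continuous_iteratedDeriv n (by exact_mod_cast hn))
      (hasCompactSupport_iteratedDeriv hc n) he
  obtain ⟨b, hb1, hb2⟩ :=
    (hev.and (eventually_norm_gaussianMollify_lt hh.continuous hc hR he)).exists
  refine ⟨gaussianMollify b h, differentiable_gaussianMollify b hh.continuous hc,
    fun t => by rw [gaussianMollify_ofReal, Complex.ofReal_im], fun n hn t => ?_, hb2⟩
  simp only [gaussianMollify_ofReal, Complex.ofReal_re]
  have hn' : ContDiff ℝ n h := hh.of_le (by exact_mod_cast hn)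
  have hconv : ContDiff ℝ n (convolution h (gaussianDensity b)
      (ContinuousLinearMap.lsmul ℝ ℝ) volume) :=
    hc.contDiff_convolution_left _ hn' (continuous_gaussianDensity b).locallyIntegrable
  rw [iteratedDeriv_fun_sub hn'.contDiffAt hconv.contDiffAt,
    iteratedDeriv_convolution_gaussianDensity b hc hn']
  exact hb1 n (by simpa [Nat.lt_succ_iff] using hn) t

/-! ### Entire approximation on the whole line -/

/-- A smooth even function on the line that vanishes for `|t| ≤ k + 1/3` and equals `1` for
`|t| ≥ k + 2/3`. -/
noncomputable def cutoff (k : ℕ) (t : ℝ) : ℝ :=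
  Real.smoothTransition ((t ^ 2 - (k + 1 / 3) ^ 2) / ((k + 2 / 3) ^ 2 - (k + 1 / 3) ^ 2))

lemma contDiff_cutoff (k : ℕ) {n : ℕ∞} : ContDiff ℝ n (cutoff k) :=
  Real.smoothTransition.contDiff.comp (by fun_prop)

lemma cutoff_gap_pos (k : ℕ) : (0 : ℝ) < (k + 2 / 3) ^ 2 - (k + 1 / 3) ^ 2 := by
  have : (0 : ℝ) ≤ k := k.cast_nonneg
  nlinarith

lemma cutoff_eq_zero {k : ℕ} {t : ℝ} (ht : |t| ≤ k + 1 / 3) : cutoff k t = 0 := by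
  apply Real.smoothTransition.zero_of_nonpos
  apply div_nonpos_of_nonpos_of_nonneg _ (cutoff_gap_pos k).le
  rw [← sq_abs t]
  have := pow_le_pow_left₀ (abs_nonneg t) ht 2
  linarith

lemma cutoff_eq_one {k : ℕ} {t : ℝ} (ht : k + 2 / 3 ≤ |t|) : cutoff k t = 1 := by
  apply Real.smoothTransition.one_of_one_le
  rw [one_le_div (cutoff_gap_pos k), ← sq_abs t]
  have := pow_le_pow_left₀ (by positivity) ht 2
  linarith

lemma hasCompactSupport_one_sub_cutoff_mul (k : ℕ) (u : ℝ → ℝ) :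
    HasCompactSupport fun t => (1 - cutoff k t) * u t := by
  refine HasCompactSupport.intro (isCompact_Icc (a := -((k : ℝ) + 1)) (b := k + 1)) fun t ht => ?_
  have : (k : ℝ) + 1 < |t| := by
    by_contra h
    exact ht (abs_le.1 (not_lt.1 h))
  rw [cutoff_eq_one (by linarith)]
  ring

/-- Multiplication by a smooth function is bounded in `C^m`, pointwise on compact sets. -/
lemma exists_forall_abs_iteratedDeriv_mul_le {θ : ℝ → ℝ} {m : ℕ} (hθ : ContDiff ℝ m θ) {K : Set ℝ}
    (hK : IsCompact K) :
    ∃ C : ℝ, 0 ≤ C ∧ ∀ u : ℝ → ℝ, ContDiff ℝ m u → ∀ t ∈ K, ∀ η : ℝ,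
      (∀ i ≤ m, |iteratedDeriv i u t| ≤ η) →
      ∀ n ≤ m, |iteratedDeriv n (fun s => θ s * u s) t| ≤ C * η := by
  have h1 : ∀ i : ℕ, ∃ M : ℝ, i ≤ m → ∀ t ∈ K, |iteratedDeriv i θ t| ≤ M := by
    intro i
    by_cases hi : i ≤ m
    · obtain ⟨M, hM⟩ := hK.exists_bound_of_continuousOn
        (hθ.continuous_iteratedDeriv i (by exact_mod_cast hi)).continuousOn
      exact ⟨M, fun _ => hM⟩
    · exact ⟨0, fun h => absurd h hi⟩
  choose M hM using h1
  refine ⟨∑ n ∈ Finset.range (m + 1), ∑ i ∈ Finset.range (n + 1), (n.choose i : ℝ) * |M i|,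
    by positivity, fun u hu t ht η hη n hn => ?_⟩
  have hη0 : 0 ≤ η := (abs_nonneg _).trans (hη 0 m.zero_le)
  have h2 := norm_iteratedFDeriv_mul_le hθ hu t (n := n) (by exact_mod_cast hn)
  simp only [norm_iteratedFDeriv_eq_norm_iteratedDeriv, Real.norm_eq_abs] at h2
  refine h2.trans ?_
  calc _ ≤ ∑ i ∈ Finset.range (n + 1), (n.choose i : ℝ) * |M i| * η := by
        refine Finset.sum_le_sum fun i hi => ?_
        have hi : i ≤ n := by simpa [Nat.lt_succ_iff] using hi
        have h3 := (hM i (hi.trans hn) t ht).trans (le_abs_self _)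
        have h4 := hη (n - i) (by omega)
        gcongr
    _ = (∑ i ∈ Finset.range (n + 1), (n.choose i : ℝ) * |M i|) * η := by rw [Finset.sum_mul]
    _ ≤ _ := by
        gcongr
        exact Finset.single_le_sum
          (f := fun n => ∑ i ∈ Finset.range (n + 1), (n.choose i : ℝ) * |M i|)
          (fun _ _ => by positivity) (Finset.mem_range.2 (Nat.lt_succ_of_le hn))

lemma contDiff_re_comp_ofReal {Φ : ℂ → ℂ} (hΦ : Differentiable ℂ Φ) {n : WithTop ℕ∞} :
    ContDiff ℝ n fun s : ℝ => (Φ s).re :=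
  Complex.reCLM.contDiff.comp
    ((hΦ.contDiff.restrict_scalars ℝ).comp Complex.ofRealCLM.contDiff)

lemma iteratedDeriv_re_comp_ofReal {Φ : ℂ → ℂ} (hΦ : Differentiable ℂ Φ) (n : ℕ) (t : ℝ) :
    iteratedDeriv n (fun s : ℝ => (Φ s).re) t = (iteratedDeriv n Φ t).re := by
  induction n generalizing t with
  | zero => simp
  | succ n ih =>
    have hd : Differentiable ℂ (iteratedDeriv n Φ) :=
      (hΦ.contDiff (n := n + 1)).differentiable_iteratedDeriv n (by norm_cast; omega)
    rw [iteratedDeriv_succ, funext ih, iteratedDeriv_succ]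
    exact (hd t).hasDerivAt.real_of_complex.deriv

lemma tendstoLocallyUniformlyOn_iteratedDeriv {F : ℕ → ℂ → ℂ} {G : ℂ → ℂ}
    (hF : ∀ j, Differentiable ℂ (F j)) (h : TendstoLocallyUniformlyOn F G atTop Set.univ) (n : ℕ) :
    TendstoLocallyUniformlyOn (fun j => iteratedDeriv n (F j)) (iteratedDeriv n G) atTop
      Set.univ := by
  induction n with
  | zero => simpa using h
  | succ n ih =>
    simp only [iteratedDeriv_succ]
    refine ih.deriv (Eventually.of_forall fun j => ?_) isOpen_univ
    exact (((hF j).contDiff (n := n + 1)).differentiable_iteratedDeriv n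
      (by norm_cast; omega)).differentiableOn

/-- The inductive step of the construction: an entire function `Φ` is corrected so as to
approximate `f` on `k + 1 ≤ |t| ≤ k + 2`. The correction is small on `|t| ≤ k` and on a disc of
radius proportional to `k`; on the transition region `k ≤ |t| ≤ k + 1` it costs a constant factor
that does not depend on `Φ`. -/
lemma exists_entire_correction {f : ℝ → ℝ} {k m M : ℕ} (hmM : m ≤ M) (hf : ContDiff ℝ M f) {C : ℝ}
    (hC : ∀ u : ℝ → ℝ, ContDiff ℝ m u → ∀ t ∈ Set.Icc (-((k : ℝ) + 1)) (k + 1), ∀ η : ℝ,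
      (∀ i ≤ m, |iteratedDeriv i u t| ≤ η) →
      ∀ n ≤ m, |iteratedDeriv n (fun s => (1 - cutoff k s) * u s) t| ≤ C * η)
    {Φ : ℂ → ℂ} (hΦ : Differentiable ℂ Φ) (hΦr : ∀ t : ℝ, (Φ t).im = 0) {e : ℝ} (he : 0 < e) :
    ∃ Ψ : ℂ → ℂ, (Differentiable ℂ Ψ ∧ ∀ t : ℝ, (Ψ t).im = 0) ∧
      (∀ t : ℝ, (k : ℝ) + 1 ≤ |t| → |t| ≤ k + 2 → ∀ n ≤ M,
        |iteratedDeriv n (fun s => f s - (Ψ s).re) t| ≤ e) ∧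
      (∀ t : ℝ, (k : ℝ) ≤ |t| → |t| ≤ k + 1 → ∀ η : ℝ,
        (∀ i ≤ m, |iteratedDeriv i (fun s => f s - (Φ s).re) t| ≤ η) →
        ∀ n ≤ m, |iteratedDeriv n (fun s => f s - (Ψ s).re) t| ≤ C * η + e) ∧
      (∀ t : ℝ, |t| ≤ k → ∀ n ≤ M, |iteratedDeriv n (fun s => f s - (Ψ s).re) t| ≤
        |iteratedDeriv n (fun s => f s - (Φ s).re) t| + e) ∧
      ∀ z, ‖z‖ < (k : ℝ) / 3 → ‖Ψ z - Φ z‖ < e := by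
  set u : ℝ → ℝ := fun s => f s - (Φ s).re with hu
  set h : ℝ → ℝ := fun s => (1 - cutoff (k + 2) s) * (cutoff k s * u s) with hh
  have hud : ContDiff ℝ M u := hf.sub (contDiff_re_comp_ofReal hΦ)
  have hχ : ∀ k, ContDiff ℝ M (cutoff k) := fun k => by exact_mod_cast contDiff_cutoff k (n := M)
  have hhd : ContDiff ℝ M h := (contDiff_const.sub (hχ _)).mul ((hχ _).mul hud)
  obtain ⟨G, hG, hGr, hG1, hG2⟩ := exists_entire_approx_of_hasCompactSupport hhd
    (hasCompactSupport_one_sub_cutoff_mul _ _) (R := k)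
    (fun t ht => by simp only [hh]; rw [cutoff_eq_zero (k := k) (by linarith)]; ring) he
  have hsplit : ∀ n ≤ M, ∀ t, iteratedDeriv n (fun s : ℝ => f s - ((Φ + G) s).re) t =
      iteratedDeriv n (fun s => u s - h s) t +
        iteratedDeriv n (fun s : ℝ => h s - (G s).re) t := by
    intro n hn t
    have hn' : (n : WithTop ℕ∞) ≤ M := by exact_mod_cast hn
    rw [← iteratedDeriv_fun_add ((hud.sub hhd).of_le hn').contDiffAt
      ((hhd.sub (contDiff_re_comp_ofReal hG)).of_le hn').contDiffAt]
    congr 1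
    ext s
    simp only [hu, Pi.add_apply, Complex.add_re]
    ring
  have hnear : ∀ {a b t : ℝ}, a < |t| → |t| < b → ∀ᶠ s in 𝓝 t, a < |s| ∧ |s| < b := by
    intro a b t h1 h2
    exact (continuous_abs.continuousAt.eventually_const_lt h1).and
      (continuous_abs.continuousAt.eventually_lt_const h2)
  -- The new error is `(u - h) + (h - G)`, and `u - h` equals `0`, `(1 - cutoff k) * u` and `u` near
  -- the points of the three regions.
  refine ⟨Φ + G, ⟨hΦ.add hG, fun t => by simp [hΦr, hGr]⟩, fun t h1 h2 n hn => ?_,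
    fun t h1 h2 η hη n hn => ?_, fun t h1 n hn => ?_, fun z hz => by simpa using hG2 z hz⟩
  · have : (fun s => u s - h s) =ᶠ[𝓝 t] fun _ => 0 := by
      filter_upwards [hnear (a := k + 2 / 3) (b := k + 2 + 1 / 3) (by linarith) (by linarith)]
        with s hs
      simp only [hh]
      rw [cutoff_eq_one hs.1.le, cutoff_eq_zero (by push_cast; exact hs.2.le)]
      ring
    rw [hsplit n hn, this.iteratedDeriv_eq]
    simpa using hG1 n hn t
  · have : (fun s => u s - h s) =ᶠ[𝓝 t] fun s => (1 - cutoff k s) * u s := by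
      filter_upwards [hnear (a := -1) (b := k + 2 + 1 / 3) (by linarith [abs_nonneg t])
        (by linarith)] with s hs
      simp only [hh]
      rw [cutoff_eq_zero (k := k + 2) (by push_cast; exact hs.2.le)]
      ring
    rw [hsplit n (hn.trans hmM), this.iteratedDeriv_eq]
    exact (abs_add_le _ _).trans (add_le_add (hC u (hud.of_le (by exact_mod_cast hmM)) t
      (abs_le.1 h2) η hη n hn) (hG1 n (hn.trans hmM) t))
  · have : (fun s => u s - h s) =ᶠ[𝓝 t] u := by
      filter_upwards [hnear (a := -1) (b := k + 1 / 3) (by linarith [abs_nonneg t])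
        (by linarith)] with s hs
      simp only [hh]
      rw [cutoff_eq_zero (k := k) hs.2.le]
      ring
    rw [hsplit n hn, this.iteratedDeriv_eq]
    exact (abs_add_le _ _).trans (add_le_add le_rfl (hG1 n hn t))

lemma exists_antitone_pos_le {δ : ℕ → ℝ} (hδ : ∀ k, 0 < δ k) :
    ∃ d : ℕ → ℝ, Antitone d ∧ ∀ k, 0 < d k ∧ d k ≤ 1 ∧ d k ≤ δ k := by
  have h0 : ∀ k, 0 < min 1 (δ k) := fun k => lt_min one_pos (hδ k)
  have h1 : ∀ k, 0 < ∏ i ∈ Finset.range k, min 1 (δ i) := fun k => Finset.prod_pos fun i _ => h0 i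
  have h2 : ∀ k, ∏ i ∈ Finset.range k, min 1 (δ i) ≤ 1 := fun k =>
    Finset.prod_le_one (fun i _ => (h0 i).le) fun i _ => min_le_left _ _
  refine ⟨fun k => ∏ i ∈ Finset.range (k + 1), min 1 (δ i), antitone_nat_of_succ_le fun k => ?_,
    fun k => ⟨h1 _, h2 _, ?_⟩⟩
  · rw [Finset.prod_range_succ _ (k + 1)]
    exact mul_le_of_le_one_right (h1 _).le (min_le_left _ _)
  · simp only [Finset.prod_range_succ]
    exact (mul_le_of_le_one_left (h0 k).le (h2 k)).trans (min_le_right _ _)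

/-- Sequences of entire functions with geometrically small consecutive differences on growing discs
converge locally uniformly on the plane. -/
lemma exists_tendstoLocallyUniformlyOn_of_norm_sub_le {F : ℕ → ℂ → ℂ}
    (h : ∀ k : ℕ, ∀ z, ‖z‖ < (k : ℝ) / 3 → ‖F (k + 1) z - F k z‖ ≤ (1 / 2) ^ k) :
    ∃ G : ℂ → ℂ, TendstoLocallyUniformlyOn F G atTop Set.univ := by
  have hdist : ∀ (R : ℕ) (z : ℂ), ‖z‖ < (R : ℝ) / 3 → ∀ j : ℕ,
      dist (F (j + R) z) (F (j + 1 + R) z) ≤ 1 * (1 / 2) ^ j := by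
    intro R z hz j
    rw [dist_comm, dist_eq_norm, add_right_comm, one_mul]
    refine (h (j + R) z (hz.trans_le ?_)).trans
      (pow_le_pow_of_le_one (by norm_num) (by norm_num) (by omega))
    push_cast
    have : (0 : ℝ) ≤ j := j.cast_nonneg
    linarith
  have hex : ∀ z : ℂ, ∃ R : ℕ, ‖z‖ < (R : ℝ) / 3 := fun z => by
    obtain ⟨R, hR⟩ := exists_nat_gt (‖z‖ * 3)
    exact ⟨R, by linarith⟩
  have hlim : ∀ z, ∃ a, Tendsto (fun j => F j z) atTop (𝓝 a) := by
    intro z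
    obtain ⟨R, hR⟩ := hex z
    obtain ⟨a, ha⟩ := cauchySeq_tendsto_of_complete
      (cauchySeq_of_le_geometric (1 / 2) 1 (by norm_num) (hdist R z hR))
    exact ⟨a, (tendsto_add_atTop_iff_nat (f := fun j => F j z) R).1 ha⟩
  choose G hG using hlim
  refine ⟨G, Metric.tendstoLocallyUniformlyOn_iff.2 fun ε hε x _ => ?_⟩
  obtain ⟨R, hR⟩ := hex x
  refine ⟨Metric.ball 0 ((R : ℝ) / 3), mem_nhdsWithin_of_mem_nhds
    (Metric.isOpen_ball.mem_nhds (by simpa using hR)), ?_⟩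
  have ht : Tendsto (fun j : ℕ => (1 : ℝ) * (1 / 2) ^ j / (1 - 1 / 2)) atTop (𝓝 0) := by
    have := ((tendsto_pow_atTop_nhds_zero_of_lt_one (r := (1 / 2 : ℝ)) (by norm_num)
      (by norm_num)).const_mul 1).div_const (1 - 1 / 2)
    simpa using this
  have hev := ht.eventually_lt_const hε
  rw [← map_add_atTop_eq_nat R, eventually_map]
  filter_upwards [hev] with j hj z hz
  rw [dist_comm]
  exact (dist_le_of_le_geometric_of_tendsto (1 / 2) 1 (by norm_num)
    (hdist R z (by simpa using hz))
    ((tendsto_add_atTop_iff_nat (f := fun j => F j z) R).2 (hG z)) j).trans_lt hj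

/-- Approximation on the whole line by entire functions, with orders of differentiation `m k` and
error bounds `δ k` prescribed on each `k ≤ |t| ≤ k + 1`. -/
theorem exists_entire_approx {f : ℝ → ℝ} {m : ℕ → ℕ} (hm : Monotone m)
    (hf : ∀ k, ContDiff ℝ (m k) f) {δ : ℕ → ℝ} (hδ : ∀ k, 0 < δ k) :
    ∃ G : ℂ → ℂ, Differentiable ℂ G ∧ (∀ t : ℝ, (G t).im = 0) ∧
      ∀ (k : ℕ) (t : ℝ), (k : ℝ) ≤ |t| → |t| ≤ k + 1 → ∀ n ≤ m k,
        |iteratedDeriv n (fun s => f s - (G s).re) t| < δ k := by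
  obtain ⟨d, hd, hd'⟩ := exists_antitone_pos_le hδ
  choose hd0 hd1 hdδ using hd'
  have hC := fun k : ℕ => exists_forall_abs_iteratedDeriv_mul_le (θ := fun s => 1 - cutoff k s)
    (m := m k) (contDiff_const.sub (by exact_mod_cast contDiff_cutoff k (n := m k)))
    (isCompact_Icc (a := -((k : ℝ) + 1)) (b := k + 1))
  choose C hC0 hC using hC
  -- The factor `1 + C k` absorbs the loss on the transition region; the geometric factor makes all
  -- later corrections summable.
  set η : ℕ → ℝ := fun k => d k * (1 / 2) ^ (k + 2) / (1 + C k) with hη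
  have hC1 : ∀ k, 0 < 1 + C k := fun k => by linarith [hC0 k]
  have hη0 : ∀ k, 0 < η k := fun k => div_pos (mul_pos (hd0 k) (by positivity)) (hC1 k)
  have hη1 : ∀ k, (1 + C k) * η k = d k * (1 / 2) ^ (k + 2) := fun k => by
    simp only [hη]; field_simp [(hC1 k).ne']
  have hη2 : ∀ k, η k ≤ d k * (1 / 2) ^ (k + 2) := fun k => by
    rw [← hη1]; nlinarith [hη0 k, hC0 k]
  obtain ⟨Φ₀, hΦ₀, hΦ₀r, hΦ₀a, -⟩ := exists_entire_approx_of_hasCompactSupport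
    (h := fun s => (1 - cutoff 1 s) * f s) (m := m 0) (R := 0)
    ((contDiff_const.sub (by exact_mod_cast contDiff_cutoff 1 (n := m 0))).mul (hf 0))
    (hasCompactSupport_one_sub_cutoff_mul 1 f)
    (fun t ht => absurd ht (not_lt.2 (abs_nonneg t))) (hη0 0)
  have step := fun (k : ℕ) (Φ : {Φ : ℂ → ℂ // Differentiable ℂ Φ ∧ ∀ t : ℝ, (Φ t).im = 0}) =>
    exists_entire_correction (hm k.le_succ) (hf (k + 1)) (hC k) Φ.2.1 Φ.2.2 (hη0 (k + 1))
  choose next hnext hA hB hD hE using step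
  let S : ℕ → {Φ : ℂ → ℂ // Differentiable ℂ Φ ∧ ∀ t : ℝ, (Φ t).im = 0} :=
    fun k => Nat.rec ⟨Φ₀, hΦ₀, hΦ₀r⟩ (fun k Φ => ⟨next k Φ, hnext k Φ⟩) k
  have hS : ∀ k, (S (k + 1)).1 = next k (S k) := fun k => rfl
  have hinit : ∀ (k : ℕ) (t : ℝ), (k : ℝ) ≤ |t| → |t| ≤ k + 1 → ∀ n ≤ m k,
      |iteratedDeriv n (fun s : ℝ => f s - ((S k).1 s).re) t| ≤ η k := by
    intro k
    cases k with
    | zero =>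
      intro t _ ht n hn
      have : (fun s : ℝ => f s - ((S 0).1 s).re) =ᶠ[𝓝 t]
          fun s => (1 - cutoff 1 s) * f s - (Φ₀ s).re := by
        have ht' : |t| < 4 / 3 := by norm_num at ht; linarith
        filter_upwards [continuous_abs.continuousAt.eventually_lt_const ht'] with s hs
        rw [cutoff_eq_zero (by norm_num; linarith)]
        simp [S]
      rw [this.iteratedDeriv_eq]
      exact hΦ₀a n hn t
    | succ k =>
      intro t h1 h2 n hn
      rw [hS]
      exact hA k (S k) t (by exact_mod_cast h1) (by push_cast at h2; linarith) n hn
  -- The transition step leaves at most half of `d k`; the subtracted term is the part of the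
  -- remaining allowance that is kept for the corrections still to come.
  have hbound : ∀ (k : ℕ) (t : ℝ), (k : ℝ) ≤ |t| → |t| ≤ k + 1 → ∀ n ≤ m k, ∀ K ≥ k + 1,
      |iteratedDeriv n (fun s : ℝ => f s - ((S K).1 s).re) t| ≤
        d k * (3 / 4 - (1 / 2) ^ K / 4) := by
    intro k t h1 h2 n hn K hK
    have hlater : ∀ K ≥ k, η (K + 1) ≤ d k * ((1 / 2) ^ K / 8) := by
      intro K hK
      refine (hη2 (K + 1)).trans ?_
      have : (1 / 2 : ℝ) ^ (K + 1 + 2) = (1 / 2) ^ K / 8 := by ring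
      rw [this]
      have := hd (show k ≤ K + 1 by omega)
      gcongr
    have hp : ∀ j : ℕ, (1 / 2 : ℝ) ^ j ≤ 1 := fun j => pow_le_one₀ (by norm_num) (by norm_num)
    induction K, hK using Nat.le_induction with
    | base =>
      rw [hS]
      refine (hB k (S k) t h1 h2 _ (hinit k t h1 h2) n hn).trans ?_
      have e1 : C k * η k ≤ d k * (1 / 4) := by
        have e2 := hη1 k
        have : (1 / 2 : ℝ) ^ (k + 2) = (1 / 2) ^ k / 4 := by ring
        rw [this] at e2
        nlinarith [hη0 k, hp k, hd0 k]
      have e3 := hlater k le_rfl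
      have e4 : (1 / 2 : ℝ) ^ (k + 1) = (1 / 2) ^ k / 2 := by ring
      rw [e4]
      nlinarith [hp k, hd0 k]
    | succ K hK ih =>
      rw [hS]
      have hkK : (k : ℝ) + 1 ≤ K := by exact_mod_cast hK
      refine (hD K (S K) t (h2.trans hkK) n (hn.trans (hm (by omega)))).trans ?_
      have e3 := hlater K (by omega)
      have e4 : (1 / 2 : ℝ) ^ (K + 1) = (1 / 2) ^ K / 2 := by ring
      rw [e4]
      linarith
  obtain ⟨G, hG⟩ := exists_tendstoLocallyUniformlyOn_of_norm_sub_le (F := fun k => (S k).1) <| by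
    intro k z hz
    refine (hE k (S k) z hz).le.trans ((hη2 _).trans ?_)
    have : (1 / 2 : ℝ) ^ (k + 1 + 2) ≤ (1 / 2) ^ k :=
      pow_le_pow_of_le_one (by norm_num) (by norm_num) (by omega)
    exact (mul_le_of_le_one_left (by positivity) (hd1 _)).trans this
  have hGd : Differentiable ℂ G := by
    rw [← differentiableOn_univ]
    exact hG.differentiableOn (Eventually.of_forall fun k => (S k).2.1.differentiableOn) isOpen_univ
  refine ⟨G, hGd, fun t => ?_, fun k t h1 h2 n hn => ?_⟩
  · have h1 := (Complex.continuous_im.tendsto _).comp (hG.tendsto_at (Set.mem_univ (t : ℂ)))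
    refine tendsto_nhds_unique h1 (tendsto_const_nhds.congr fun k => ?_)
    exact ((S k).2.2 t).symm
  · have hsub : ∀ Ψ : ℂ → ℂ, Differentiable ℂ Ψ →
        iteratedDeriv n (fun s : ℝ => f s - (Ψ s).re) t =
          iteratedDeriv n f t - (iteratedDeriv n Ψ t).re := by
      intro Ψ hΨ
      rw [iteratedDeriv_fun_sub ((hf k).of_le (by exact_mod_cast hn)).contDiffAt
        (contDiff_re_comp_ofReal hΨ).contDiffAt, iteratedDeriv_re_comp_ofReal hΨ]
    have hlim : Tendsto (fun K => |iteratedDeriv n (fun s : ℝ => f s - ((S K).1 s).re) t|) atTop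
        (𝓝 |iteratedDeriv n (fun s : ℝ => f s - (G s).re) t|) := by
      rw [hsub G hGd]
      simp only [fun K => hsub (S K).1 (S K).2.1]
      have := (tendstoLocallyUniformlyOn_iteratedDeriv (fun j => (S j).2.1) hG n).tendsto_at
        (Set.mem_univ (t : ℂ))
      exact (((Complex.continuous_re.tendsto _).comp this).const_sub _).abs
    have hle : |iteratedDeriv n (fun s : ℝ => f s - (G s).re) t| ≤ d k * (3 / 4) := by
      refine le_of_tendsto hlim ?_
      filter_upwards [eventually_ge_atTop (k + 1)] with K hK
      refine (hbound k t h1 h2 n hn K hK).trans ?_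
      have := hd0 k
      gcongr
      have : (0 : ℝ) ≤ (1 / 2) ^ K := by positivity
      linarith
    linarith [hdδ k, hd0 k]

/-! ### Transfer to a subset of the line along a coordinate -/

lemma analyticOnNhd_re_comp_ofReal {U : Set ℂ} (hU : IsOpen U) {I : Set ℝ}
    (hIU : ∀ t ∈ I, (t : ℂ) ∈ U) {φ : ℂ → ℂ} (hφ : DifferentiableOn ℂ φ U) :
    AnalyticOnNhd ℝ (fun t : ℝ => (φ t).re) I := by
  intro t ht
  have h1 : AnalyticAt ℝ φ (Complex.ofRealCLM t) :=
    (hφ.analyticOnNhd hU t (hIU t ht)).restrictScalars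
  exact (Complex.reCLM.analyticAt _).comp (h1.comp (Complex.ofRealCLM.analyticAt t))

/-- The approximation problem on `I` follows from the one on the line once `I` carries a real
coordinate `φ`, holomorphic on `U`, with a smooth inverse `ψ : ℝ → I`. -/
theorem exists_holomorphic_approx_of_coordinate {I : Set ℝ} {U : Set ℂ} (hI : IsOpen I)
    (hU : IsOpen U) (hIU : ∀ t ∈ I, (t : ℂ) ∈ U) {φ : ℂ → ℂ} (hφ : DifferentiableOn ℂ φ U)
    (hφr : ∀ t ∈ I, (φ t).im = 0) {ψ : ℝ → ℝ} (hψ : ∀ n : ℕ, ContDiff ℝ n ψ) (hψI : ∀ u, ψ u ∈ I)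
    (hψφ : ∀ t ∈ I, ψ (φ t).re = t) {r : ℕ∞} {f ε ρ : ℝ → ℝ} (hf : ContDiffOn ℝ r f I)
    (hε : ContinuousOn ε I) (hρ : ContinuousOn ρ I) (hεpos : ∀ t ∈ I, 0 < ε t)
    (hρr : ∀ m : ℕ, r = (m : ℕ∞) → ∀ t ∈ I, ρ t ≤ (m : ℝ)) :
    ∃ G : ℂ → ℂ, DifferentiableOn ℂ G U ∧ (∀ t ∈ I, (G t).im = 0) ∧
      ∀ t ∈ I, ∀ n : ℕ, (n : ℝ) ≤ ρ t →
        |iteratedDeriv n (fun s => f s - (G s).re) t| < ε t := by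
  set φr : ℝ → ℝ := fun t => (φ t).re with hφr_def
  have hφan : AnalyticOnNhd ℝ φr I := analyticOnNhd_re_comp_ofReal hU hIU hφ
  have hφof : ∀ t ∈ I, φ t = (φr t : ℂ) := fun t ht =>
    Complex.ext rfl (by rw [hφr t ht, Complex.ofReal_im])
  set T : ℕ → Set ℝ := fun k => ψ '' Set.Icc (-((k : ℝ) + 1)) (k + 1) with hT
  have hTc : ∀ k, IsCompact (T k) := fun k => isCompact_Icc.image (hψ 0).continuous
  have hTI : ∀ k, T k ⊆ I := fun k => by rintro _ ⟨u, -, rfl⟩; exact hψI u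
  have hTmem : ∀ (k : ℕ), ∀ t ∈ I, |φr t| ≤ k + 1 → t ∈ T k := fun k t ht h =>
    ⟨φr t, abs_le.1 h, hψφ t ht⟩
  -- Orders of differentiation on the compact sets `T k`.
  obtain ⟨m, hm, hmr, hρm⟩ : ∃ m : ℕ → ℕ, Monotone m ∧ (∀ k, (m k : ℕ∞) ≤ r) ∧
      ∀ k, ∀ t ∈ T k, ρ t ≤ m k := by
    cases hr : r with
    | coe m => exact ⟨fun _ => m, monotone_const, fun _ => le_rfl,
        fun k t ht => hρr m hr t (hTI k ht)⟩
    | top =>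
      have h1 := fun k => (hTc k).exists_bound_of_continuousOn (hρ.mono (hTI k))
      choose N hN using h1
      refine ⟨fun k => ∑ i ∈ Finset.range (k + 1), ⌈N i⌉₊, monotone_nat_of_le_succ fun k => ?_,
        fun _ => le_top, fun k t ht => ?_⟩
      · rw [Finset.sum_range_succ _ (k + 1)]
        exact Nat.le_add_right _ _
      · refine ((le_abs_self _).trans (hN k t ht)).trans ((Nat.le_ceil _).trans ?_)
        exact_mod_cast Finset.single_le_sum (f := fun i => ⌈N i⌉₊) (fun _ _ => Nat.zero_le _)
          (Finset.self_mem_range_succ k)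
  have hφC : ∀ n : ℕ, ContDiffOn ℝ n φr I := fun n => hφan.contDiffOn hI.uniqueDiffOn
  obtain ⟨D, hD1, hD⟩ : ∃ D : ℕ → ℝ, (∀ k, 1 ≤ D k) ∧
      ∀ k, ∀ i ≤ m k, ∀ t ∈ T k, |iteratedDerivWithin i φr I t| ≤ D k := by
    have h1 : ∀ k i, ∃ M : ℝ, ∀ t ∈ T k, |iteratedDerivWithin i φr I t| ≤ M := fun k i =>
      (hTc k).exists_bound_of_continuousOn (((hφC i).continuousOn_iteratedDerivWithin le_rfl
        hI.uniqueDiffOn).mono (hTI k))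
    choose M hM using h1
    refine ⟨fun k => 1 + ∑ i ∈ Finset.range (m k + 1), |M k i|,
      fun k => le_add_of_nonneg_right (by positivity), fun k i hi t ht => ?_⟩
    have h2 := Finset.single_le_sum (f := fun i => |M k i|) (fun _ _ => abs_nonneg _)
      (Finset.mem_range.2 (Nat.lt_succ_of_le hi))
    have h3 := (hM k i t ht).trans (le_abs_self _)
    linarith
  obtain ⟨e, he0, he⟩ : ∃ e : ℕ → ℝ, (∀ k, 0 < e k) ∧ ∀ k, ∀ t ∈ T k, e k ≤ ε t := by
    have h1 : ∀ k, ∃ e : ℝ, 0 < e ∧ ∀ t ∈ T k, e ≤ ε t := by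
      intro k
      obtain ⟨x, hx, hmin⟩ := (hTc k).exists_isMinOn
        ((Set.nonempty_Icc.2 (by have : (0 : ℝ) ≤ k := k.cast_nonneg
                                 linarith)).image ψ) (hε.mono (hTI k))
      exact ⟨ε x, hεpos x (hTI k hx), fun t ht => hmin ht⟩
    choose e h2 h3 using h1
    exact ⟨e, h2, h3⟩
  have hB : ∀ k, 0 < ((m k).factorial : ℝ) * D k ^ m k := fun k =>
    mul_pos (by positivity) (pow_pos (one_pos.trans_le (hD1 k)) _)
  have hfψ : ∀ k, ContDiff ℝ (m k) (f ∘ ψ) := fun k =>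
    (hf.of_le (by exact_mod_cast hmr k)).comp_contDiff (hψ _) hψI
  -- The bounds on the line are those which the Faà di Bruno formula requires.
  obtain ⟨G, hG, hGr, hGa⟩ := exists_entire_approx hm hfψ
    (δ := fun k => e k / 2 / ((m k).factorial * D k ^ m k))
    (fun k => div_pos (half_pos (he0 k)) (hB k))
  refine ⟨G ∘ φ, hG.comp_differentiableOn hφ, fun t ht => ?_, fun t ht n hn => ?_⟩
  · rw [Function.comp_apply, hφof t ht, hGr]
  set k := ⌊|φr t|⌋₊ with hk
  have hk1 : (k : ℝ) ≤ |φr t| := Nat.floor_le (abs_nonneg _)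
  have hk2 : |φr t| ≤ k + 1 := (Nat.lt_floor_add_one _).le
  have htT := hTmem k t ht hk2
  have hnm : n ≤ m k := by exact_mod_cast hn.trans (hρm k t htT)
  set h : ℝ → ℝ := fun u => (f ∘ ψ) u - (G u).re with hh
  have hhC : ContDiff ℝ n h := ((hfψ k).of_le (by exact_mod_cast hnm)).sub
    (contDiff_re_comp_ofReal hG)
  have heq : Set.EqOn (fun s : ℝ => f s - ((G ∘ φ) s).re) (h ∘ φr) I := by
    intro s hs
    simp only [hh, Function.comp_apply]
    rw [hψφ s hs, hφof s hs]
  have hcomp := norm_iteratedFDerivWithin_comp_le (n := n) (N := n) hhC.contDiffOn (hφC n) le_rfl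
    uniqueDiffOn_univ hI.uniqueDiffOn (Set.mapsTo_univ _ _) ht
    (C := e k / 2 / ((m k).factorial * D k ^ m k)) (D := D k)
    (fun i hi => by
      rw [iteratedFDerivWithin_univ, norm_iteratedFDeriv_eq_norm_iteratedDeriv]
      exact (hGa k (φr t) hk1 hk2 i (hi.trans hnm)).le)
    (fun i hi1 hi => by
      rw [norm_iteratedFDerivWithin_eq_norm_iteratedDerivWithin]
      exact (hD k i (hi.trans hnm) t htT).trans (le_self_pow₀ (hD1 k) (by omega)))
  rw [norm_iteratedFDerivWithin_eq_norm_iteratedDerivWithin,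
    iteratedDerivWithin_of_isOpen hI ht, Real.norm_eq_abs] at hcomp
  rw [(heq.eventuallyEq_of_mem (hI.mem_nhds ht)).iteratedDeriv_eq]
  refine hcomp.trans_lt (lt_of_lt_of_le ?_ (he k t htT))
  have h1 : (n.factorial : ℝ) * D k ^ n ≤ (m k).factorial * D k ^ m k := by
    have := hD1 k
    gcongr
  have h2 := he0 k
  have h3 := hB k
  calc (n.factorial : ℝ) * (e k / 2 / ((m k).factorial * D k ^ m k)) * D k ^ n
      = (n.factorial * D k ^ n) * (e k / 2 / ((m k).factorial * D k ^ m k)) := by ring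
    _ ≤ ((m k).factorial * D k ^ m k) * (e k / 2 / ((m k).factorial * D k ^ m k)) := by gcongr
    _ = e k / 2 := mul_div_cancel₀ _ h3.ne'
    _ < e k := by linarith

/-! ### Rational coordinates on open intervals -/

/-- A nonempty open interval carries a rational real coordinate, holomorphic on the plane without
the finite endpoints and with a smooth inverse: up to affine substitutions it is `w`, `w - 1 / w` or
`2w / (1 - w²) = 1 / (1 - w) - 1 / (1 + w)` when no, one or both endpoints are finite. -/
lemma exists_coordinate {α β : EReal} (hαβ : α < β) :
    ∃ (φ : ℂ → ℂ) (ψ : ℝ → ℝ), DifferentiableOn ℂ φ (planeMinusEndpoints α β) ∧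
      (∀ t ∈ realInterval α β, (φ t).im = 0) ∧ (∀ n : ℕ, ContDiff ℝ n ψ) ∧
      (∀ u, ψ u ∈ realInterval α β) ∧ ∀ t ∈ realInterval α β, ψ (φ t).re = t := by
  have hsqrt : ∀ u : ℝ, |u| < √(u ^ 2 + 4) := fun u => by
    rw [← Real.sqrt_sq_eq_abs]; exact Real.sqrt_lt_sqrt (sq_nonneg u) (by linarith)
  have hsqrtC : ∀ n : ℕ, ContDiff ℝ n fun u : ℝ => √(u ^ 2 + 4) := fun n =>
    ContDiff.sqrt (by fun_prop) fun u => by positivity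
  have hsqrt1 : ∀ x : ℝ, 0 < x → √((x - x⁻¹) ^ 2 + 4) = x + x⁻¹ := fun x hx => by
    rw [show (x - x⁻¹) ^ 2 + 4 = (x + x⁻¹) ^ 2 by field_simp; ring]
    exact Real.sqrt_sq (by positivity)
  induction α with
  | top => exact absurd hαβ not_top_lt
  | bot =>
    induction β with
    | bot => exact absurd hαβ (lt_irrefl _)
    | top =>
      exact ⟨id, id, differentiableOn_id, fun t _ => by simp, fun n => contDiff_id,
        fun u => ⟨EReal.bot_lt_coe u, EReal.coe_lt_top u⟩, fun t _ => by simp⟩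
    | coe b =>
      refine ⟨fun z => (b - z)⁻¹ - (b - z), fun u => b - (√(u ^ 2 + 4) - u) / 2, ?_, fun t _ => ?_,
        fun n => ?_, fun u => ⟨EReal.bot_lt_coe _, ?_⟩, fun t ht => ?_⟩
      · intro z hz
        have : (b : ℂ) - z ≠ 0 := sub_ne_zero.2 (hz b (Or.inr rfl)).symm
        fun_prop (disch := assumption)
      · simp only
        norm_cast
      · have := hsqrtC n
        fun_prop
      · have := (abs_lt.1 (hsqrt u)).2
        exact_mod_cast (by linarith : b - (√(u ^ 2 + 4) - u) / 2 < b)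
      · have hx : 0 < b - t := sub_pos.2 (by exact_mod_cast ht.2)
        have hre : ((b - t : ℂ)⁻¹ - (b - t)).re = (b - t)⁻¹ - (b - t) := by norm_cast
        simp only [hre]
        rw [← neg_sub (b - t), neg_sq, hsqrt1 _ hx]
        ring
  | coe a =>
    induction β with
    | bot => exact absurd hαβ not_lt_bot
    | top =>
      refine ⟨fun z => (z - a) - (z - a)⁻¹, fun u => a + (√(u ^ 2 + 4) + u) / 2, ?_, fun t _ => ?_,
        fun n => ?_, fun u => ⟨?_, EReal.coe_lt_top _⟩, fun t ht => ?_⟩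
      · intro z hz
        have : z - (a : ℂ) ≠ 0 := sub_ne_zero.2 (hz a (Or.inl rfl))
        fun_prop (disch := assumption)
      · simp only
        norm_cast
      · have := hsqrtC n
        fun_prop
      · have := (abs_lt.1 (hsqrt u)).1
        exact_mod_cast (by linarith : a < a + (√(u ^ 2 + 4) + u) / 2)
      · have hx : 0 < t - a := sub_pos.2 (by exact_mod_cast ht.1)
        have hre : ((t - a : ℂ) - (t - a : ℂ)⁻¹).re = (t - a) - (t - a)⁻¹ := by norm_cast
        simp only [hre]
        rw [hsqrt1 _ hx]
        ring
    | coe b =>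
      have hab : a < b := by exact_mod_cast hαβ
      set c : ℝ := (a + b) / 2 with hc
      set d : ℝ := (b - a) / 2 with hd
      have hd0 : 0 < d := by rw [hd]; linarith
      have hcd : b = c + d ∧ a = c - d := by constructor <;> rw [hc, hd] <;> ring
      have hpos : ∀ u : ℝ, 0 < 1 + √(u ^ 2 + 1) := fun u => by positivity
      have hlt : ∀ u : ℝ, |u / (1 + √(u ^ 2 + 1))| < 1 := fun u => by
        rw [abs_div, abs_of_pos (hpos u), div_lt_one (hpos u)]
        have : |u| ≤ √(u ^ 2 + 1) := by
          rw [← Real.sqrt_sq_eq_abs]; exact Real.sqrt_le_sqrt (by linarith)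
        linarith
      refine ⟨fun z => d * ((b - z)⁻¹ - (z - a)⁻¹), fun u => c + d * (u / (1 + √(u ^ 2 + 1))), ?_,
        fun t _ => ?_, fun n => ?_, fun u => ⟨?_, ?_⟩, fun t ht => ?_⟩
      · intro z hz
        have h1 : z - (a : ℂ) ≠ 0 := sub_ne_zero.2 (hz a (Or.inl rfl))
        have h2 : (b : ℂ) - z ≠ 0 := sub_ne_zero.2 (hz b (Or.inr rfl)).symm
        fun_prop (disch := assumption)
      · simp only
        norm_cast
      · have h1 : ContDiff ℝ n fun u : ℝ => √(u ^ 2 + 1) :=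
          ContDiff.sqrt (by fun_prop) fun u => by positivity
        exact contDiff_const.add (contDiff_const.mul
          (contDiff_id.div (contDiff_const.add h1) fun u => (hpos u).ne'))
      · have h1 := (abs_lt.1 (hlt u)).1
        have : a < c + d * (u / (1 + √(u ^ 2 + 1))) := by rw [hcd.2]; nlinarith
        exact_mod_cast this
      · have h1 := (abs_lt.1 (hlt u)).2
        have : c + d * (u / (1 + √(u ^ 2 + 1))) < b := by rw [hcd.1]; nlinarith
        exact_mod_cast this
      · have ha : a < t := by exact_mod_cast ht.1
        have hb : t < b := by exact_mod_cast ht.2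
        have hre : ((d : ℂ) * ((b - t : ℂ)⁻¹ - (t - a : ℂ)⁻¹)).re =
            d * ((b - t)⁻¹ - (t - a)⁻¹) := by norm_cast
        simp only [hre]
        obtain ⟨w, htw⟩ : ∃ w, t = c + d * w := ⟨(t - c) / d, by field_simp; ring⟩
        have hw1 : 0 < 1 - w := by
          rw [hcd.1, htw] at hb; nlinarith
        have hw2 : 0 < 1 + w := by
          rw [hcd.2, htw] at ha; nlinarith
        have hu : d * ((b - t)⁻¹ - (t - a)⁻¹) = 2 * w / ((1 - w) * (1 + w)) := by
          rw [show b - t = d * (1 - w) by rw [hcd.1, htw]; ring,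
            show t - a = d * (1 + w) by rw [hcd.2, htw]; ring]
          field_simp
          ring
        have hs : √((2 * w / ((1 - w) * (1 + w))) ^ 2 + 1) = (1 + w ^ 2) / ((1 - w) * (1 + w)) := by
          rw [show (2 * w / ((1 - w) * (1 + w))) ^ 2 + 1 =
            ((1 + w ^ 2) / ((1 - w) * (1 + w))) ^ 2 by field_simp; ring]
          exact Real.sqrt_sq (by positivity)
        have hq : 2 * w / ((1 - w) * (1 + w)) / (1 + (1 + w ^ 2) / ((1 - w) * (1 + w))) = w := by
          have : (1 - w) * (1 + w) + (1 + w ^ 2) = 2 := by ring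
          rw [one_add_div (mul_pos hw1 hw2).ne', this]
          field_simp
        rw [hu, hs, hq, ← htw]

lemma isOpen_realInterval (α β : EReal) : IsOpen (realInterval α β) :=
  (isOpen_Ioo (a := α) (b := β)).preimage continuous_coe_real_ereal

lemma isOpen_planeMinusEndpoints (α β : EReal) : IsOpen (planeMinusEndpoints α β) := by
  have h : planeMinusEndpoints α β =
      (((↑) : ℝ → ℂ) '' {a : ℝ | (a : EReal) = α ∨ (a : EReal) = β})ᶜ := by
    ext z
    simp only [planeMinusEndpoints, Set.mem_ofPred_eq, Set.mem_compl_iff, Set.mem_image, not_exists,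
      not_and]
    exact forall₂_congr fun a _ => ne_comm
  have hsub : ∀ γ : EReal, Set.Subsingleton {a : ℝ | (a : EReal) = γ} := fun γ a ha b hb =>
    EReal.coe_injective (ha.trans hb.symm)
  rw [h]
  exact (((hsub α).finite.union (hsub β).finite).image _).isClosed.isOpen_compl

lemma ofReal_mem_planeMinusEndpoints {α β : EReal} {t : ℝ} (ht : t ∈ realInterval α β) :
    (t : ℂ) ∈ planeMinusEndpoints α β := by
  intro a ha h
  obtain rfl := Complex.ofReal_injective h
  rcases ha with rfl | rfl
  · exact lt_irrefl _ ht.1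
  · exact lt_irrefl _ ht.2

theorem theorem1 (α β : EReal) (hαβ : α < β) (r : ℕ∞)
    (f ε ρ : ℝ → ℝ)
    (hf : ContDiffOn ℝ r f (realInterval α β))
    (hε : ContinuousOn ε (realInterval α β))
    (hρ : ContinuousOn ρ (realInterval α β))
    (hεpos : ∀ t ∈ realInterval α β, 0 < ε t)
    (hρ0 : ∀ t ∈ realInterval α β, 0 ≤ ρ t)
    (hρr : ∀ m : ℕ, r = (m : ℕ∞) → ∀ t ∈ realInterval α β, ρ t ≤ (m : ℝ)) :
    ∃ g : ℝ → ℝ,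
      AnalyticOnNhd ℝ g (realInterval α β) ∧
      (∀ t ∈ realInterval α β, ∀ n : ℕ, (n : ℝ) ≤ ρ t →
        |iteratedDeriv n (fun s => f s - g s) t| < ε t) ∧
      ∃ G : ℂ → ℂ,
        DifferentiableOn ℂ G (planeMinusEndpoints α β) ∧
        ∀ t ∈ realInterval α β, G (t : ℂ) = (g t : ℂ) := by
  have hI := isOpen_realInterval α β
  have hU := isOpen_planeMinusEndpoints α β
  have hIU : ∀ t ∈ realInterval α β, (t : ℂ) ∈ planeMinusEndpoints α β :=
    fun t => ofReal_mem_planeMinusEndpoints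
  obtain ⟨φ, ψ, hφ, hφr, hψ, hψI, hψφ⟩ := exists_coordinate hαβ
  obtain ⟨G, hG, hGr, hGa⟩ := exists_holomorphic_approx_of_coordinate hI hU hIU hφ hφr hψ hψI hψφ
    hf hε hρ hεpos hρr
  exact ⟨fun t => (G t).re, analyticOnNhd_re_comp_ofReal hU hIU hG, hGa, G, hG,
    fun t ht => Complex.ext rfl (by rw [hGr t ht, Complex.ofReal_im])⟩
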